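/- Let $p_1,\dots,p_k,q_1,\dots,q_k\in\mathbb R$ be such that the polynomials $P(z)=1+\sum_{n=1}^k p_nz^n$ and $Q(z)=1+\sum_{n=1}^k q_nz^n$ are coprime, at least one of them has degree $k$, and all their zeros lie strictly outside the unit circle. (Then $|P(e^{i\theta})/Q(e^{i\theta})|^2$ is the ARMA($k$) noise spectrum.) Let $F\in\mathbb R^{k\times k}$ have first row $(-q_1,\dots,-q_k)$, ones on the subdiagonal and zeros elsewhere, let $G=(1,0,\dots,0)'\in\mathbb R^{k\times 1}$ and $H=(p_1-q_1,\dots,p_k-q_k)\in\mathbb R^{1\times k}$. For $X\in\mathbb R^{1\times k}$ consider the discrete algebraic Riccati equation $$\Sigma=F\Sigma F'+GG'-\frac{(F\Sigma(X+H)'+G)(F\Sigma(X+H)'+G)'}{1+(X+H)\Sigma(X+H)'}\qquad(*)$$ for symmetric $\Sigma$, and consider the maximization, for power $\mathcal P$, in the ARMA($k$) feedback capacity formula $$\max_X\ \tfrac12\log\bigl(1+(X+H)\Sigma_+(X)(X+H)'\bigr)\qquad(**)$$ over all $X\in\mathbb R^{1\times k}$ such that $F-G(X+H)$ has no eigenvalue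 on the unit circle and $X\Sigma_+(X)X'\le \mathcal P$, where $\Sigma_+(X)$ is the maximal solution of $(*)$. Let $X\in\mathbb R^{1\times k}$, and let $\Sigma_+$ be a stabilizing solution of $(*)$, that is, all eigenvalues of $F-\Gamma(X+H)$ lie strictly inside the unit circle, where $\sigma^2=1+(X+H)\Sigma_+(X+H)'$ and $\Gamma=\sigma^{-2}(F\Sigma_+(X+H)'+G)$. Assume that $F-\Gamma H$ has no eigenvalue outside the closed unit disc (so that the state estimate $\hat S_{n+1}=(F-\Gamma H)\hat S_n+\Gamma Y_n$ is causally determined by the output). Put $$S_Y(z)=\sigma^2\,\frac{\det(I-z(F-\Gamma H))}{\det(I-zF)}\,\frac{\det(I-z^{-1}(F-\Gamma H))}{\det(I-z^{-1}F)}.$$ Suppose that 1. (Power) $X\Sigma_+X'=\mathcal P$; 2. (Eigenvalues) $F-G(X+H)$ has distinct eigenvalues $\alpha_1,\dots,\alpha_k\in\mathbb C$, all with $|\alpha_i|>1$; 3. (Spectrum) the denominators in $S_Y$ do not vanish at $\alpha_1,\dots,\alpha_k$, and $0<S_Y(\alpha_1)=\dots=S_Y(\alpha_k)\le\min_{|z|=1}S_Y(z)$.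 Then $\Sigma_+\succ0$, $\Sigma_+$ is the maximal solution of $(*)$, and $X$ attains the maximum in $(**)$. -/

import Mathlib

open Matrix Polynomial

namespace GaussianFeedback

/-- The polynomial `1 + c₁ z + ⋯ + c_k z^k`. -/
noncomputable def unitPoly {k : ℕ} (c : Fin k → ℝ) : ℝ[X] :=
  1 + ∑ i : Fin k, C (c i) * X ^ ((i : ℕ) + 1)

/-- A polynomial is stable if all its complex zeros lie strictly outside the unit circle. -/
def IsStablePoly (f : ℝ[X]) : Prop := ∀ z : ℂ, aeval z f = 0 → 1 < ‖z‖

/-- `H_Z = (1 + ∑ pₙ zⁿ) / (1 + ∑ qₙ zⁿ)` is the canonical factor of an ARMA(`k`) spectrum. -/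
structure IsARMA {k : ℕ} (p q : Fin k → ℝ) : Prop where
  stable_num : IsStablePoly (unitPoly p)
  stable_den : IsStablePoly (unitPoly q)
  coprime : IsCoprime (unitPoly p) (unitPoly q)
  degree : (unitPoly p).natDegree = k ∨ (unitPoly q).natDegree = k

/-- The state matrix: first row `(-q₁, …, -q_k)`, ones on the subdiagonal, zeros elsewhere. -/
def stateF {k : ℕ} (q : Fin k → ℝ) : Matrix (Fin k) (Fin k) ℝ :=
  Matrix.of fun i j => if (i : ℕ) = 0 then -q j else if (i : ℕ) = (j : ℕ) + 1 then 1 else 0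

/-- The input column `(1, 0, …, 0)'`. -/
def inputG (k : ℕ) : Fin k → ℝ := fun i => if (i : ℕ) = 0 then 1 else 0

/-- The output row `(p₁ - q₁, …, p_k - q_k)`. -/
def outputH {k : ℕ} (p q : Fin k → ℝ) : Fin k → ℝ := fun i => p i - q i

/-- The set of complex eigenvalues of a real square matrix. -/
def eigenvaluesC {k : ℕ} (M : Matrix (Fin k) (Fin k) ℝ) : Set ℂ :=
  spectrum ℂ (M.map (algebraMap ℝ ℂ))

/-- The innovation variance `1 + h S h'` (`h` is a row). -/
def innovVar {k : ℕ} (h : Fin k → ℝ) (S : Matrix (Fin k) (Fin k) ℝ) : ℝ :=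
  1 + h ⬝ᵥ (S *ᵥ h)

/-- The gain `Γ = (F S h' + G) / (1 + h S h')`. -/
noncomputable def gain {k : ℕ} (F : Matrix (Fin k) (Fin k) ℝ) (G h : Fin k → ℝ)
    (S : Matrix (Fin k) (Fin k) ℝ) : Fin k → ℝ :=
  (innovVar h S)⁻¹ • (F *ᵥ (S *ᵥ h) + G)

/-- `S` is a symmetric solution of the discrete algebraic Riccati equation
`S = F S F' + G G' - (F S h' + G) (F S h' + G)' / (1 + h S h')`. -/
structure IsDARESol {k : ℕ} (F : Matrix (Fin k) (Fin k) ℝ) (G h : Fin k → ℝ)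
    (S : Matrix (Fin k) (Fin k) ℝ) : Prop where
  symm : S.IsSymm
  denom_ne : innovVar h S ≠ 0
  eq : S = F * S * Fᵀ + vecMulVec G G -
    (innovVar h S)⁻¹ • vecMulVec (F *ᵥ (S *ᵥ h) + G) (F *ᵥ (S *ᵥ h) + G)

/-- A stabilizing solution: all eigenvalues of `F - Γ h` are inside the unit circle. -/
structure IsStabilizingSol {k : ℕ} (F : Matrix (Fin k) (Fin k) ℝ) (G h : Fin k → ℝ)
    (S : Matrix (Fin k) (Fin k) ℝ) : Prop where
  sol : IsDARESol F G h S
  stable : ∀ μ ∈ eigenvaluesC (F - vecMulVec (gain F G h S) h), ‖μ‖ < 1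

/-- The maximal solution: it dominates every solution in the positive semidefinite order. -/
structure IsMaximalSol {k : ℕ} (F : Matrix (Fin k) (Fin k) ℝ) (G h : Fin k → ℝ)
    (S : Matrix (Fin k) (Fin k) ℝ) : Prop where
  sol : IsDARESol F G h S
  maximal : ∀ T, IsDARESol F G h T → (S - T).PosSemidef

/-- `X` lies in the domain of the maximization for power `Pw`, with `S = Σ₊(X)`:
`F - G (X + H)` has no eigenvalue on the unit circle, `S` is the maximal solution of the
Riccati equation of `X`, and `X S X' ≤ Pw`. -/
structure IsAdmissible {k : ℕ} (p q : Fin k → ℝ) (Pw : ℝ) (X : Fin k → ℝ)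
    (S : Matrix (Fin k) (Fin k) ℝ) : Prop where
  no_unit : ∀ μ ∈ eigenvaluesC (stateF q - vecMulVec (inputG k) (X + outputH p q)), ‖μ‖ ≠ 1
  maximal : IsMaximalSol (stateF q) (inputG k) (X + outputH p q) S
  power : X ⬝ᵥ (S *ᵥ X) ≤ Pw

/-- The objective `(1/2) log (1 + (X + H) S (X + H)')`. -/
noncomputable def rate {k : ℕ} (p q : Fin k → ℝ) (X : Fin k → ℝ)
    (S : Matrix (Fin k) (Fin k) ℝ) : ℝ :=
  1 / 2 * Real.log (innovVar (X + outputH p q) S)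

/-- `det (I - z M)`. -/
noncomputable def revDet {k : ℕ} (M : Matrix (Fin k) (Fin k) ℝ) (z : ℂ) : ℂ :=
  (1 - z • M.map (algebraMap ℝ ℂ)).det

/-- The matrix `F - Γ H`, with the gain `Γ` belonging to `X`. It drives the state estimate:
`Ŝ_{n+1} = (F - Γ H) Ŝ_n + Γ Y_n`. -/
noncomputable def estimatorMatrix {k : ℕ} (p q : Fin k → ℝ) (X : Fin k → ℝ)
    (S : Matrix (Fin k) (Fin k) ℝ) : Matrix (Fin k) (Fin k) ℝ :=
  stateF q - vecMulVec (gain (stateF q) (inputG k) (X + outputH p q) S) (outputH p q)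

/-- The output spectrum
`S_Y(z) = σ² · det(I - z(F - ΓH)) / det(I - zF) · det(I - z⁻¹(F - ΓH)) / det(I - z⁻¹F)`.
Where a denominator vanishes the formula has no value; the value `0` that division by zero
gives there does not satisfy `0 < S_Y(z)`. -/
noncomputable def outputSpectrum {k : ℕ} (p q : Fin k → ℝ) (X : Fin k → ℝ)
    (S : Matrix (Fin k) (Fin k) ℝ) (z : ℂ) : ℂ :=
  (innovVar (X + outputH p q) S : ℂ) *
    (revDet (estimatorMatrix p q X S) z / revDet (stateF q) z) *
    (revDet (estimatorMatrix p q X S) z⁻¹ / revDet (stateF q) z⁻¹)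

end GaussianFeedback

/-!
The problem is relaxed to a semidefinite program and solved by exhibiting a dual certificate.
Write `h = X + H`, let `Γ` be the gain of `S` and `σ²` its innovation variance.

A dual certificate consists of a symmetric matrix `A` and multipliers `ν`, `μ` such that
`|F x + Γ y|²_A - |x|²_A + ν (h x + y)² - μ (H x + y)² + y² = 0` for every state `x` and input `y`.
Every solution `S'` of the Riccati equation of another row `X'`, with gain `Γ'` and innovation
variance `σ'²`, satisfies a Lyapunov equation in Joseph form (`IsDARESol.joseph`) with the gain `Γ`
in place of `Γ'`. Pairing it with `A` gives (`IsDualCertificate.innovVar_eq`)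
`σ'² = const + μ X' S' X'' - ν (X - X') S' (X - X')' - σ'² |Γ' - Γ|²_A`, with a constant that does
not depend on `X'`. Both last terms vanish for `X' = X`. Since `T = 0` solves every one of these
Riccati equations, a maximal solution `S'` is positive semidefinite, and with the power constraint
on `X' S' X''` the bound `σ'² ≤ σ²` follows once `A`, `ν` and `μ` are nonnegative. For `A` the
feedback `y = -H x` turns the identity into a Lyapunov equation of the estimator matrix `F - Γ H`,
which is stable because the output spectrum has no zero on the unit circle.

The certificate comes from the spectral condition, with `μ = σ² / lam`, in the manner of the
Kalman-Yakubovich-Popov lemma. In the frequency domain the identity reads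
`S_Y(z) / lam - 1 = ν B(z) B(z⁻¹)` with `B(z) = det (z - F + Γ h) / det (z - F)`. After clearing
denominators the difference of both sides is a self-reciprocal polynomial of degree at most `2 k`
(`spectralGap`). By the identity `S = (F - Γ h) S (F - G h)'` the eigenvalues of `F - Γ h` are the
reciprocals of the `α i`, so the difference vanishes at all `α i` and at their reciprocals; choosing
`ν` to make it vanish at `1` as well makes it zero (`spectralGap_eq_zero`), and `S_Y(1) ≥ lam` gives
`ν ≥ 0`. To return to the state space, `A` is defined by the first of the three matrix equations of
the certificate. The residuals of the other two then vanish since the spectral gap does, because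
`det (z - F)` is coprime to its reversal and `(F, Γ)` is controllable. Controllability fails only if
the reciprocal of some `α i` is an eigenvalue of `F`; this is excluded, since the output spectrum
would then have a vanishing denominator at `α i`.

Maximality and positive definiteness of `S` itself are Lyapunov arguments with the closed loop
matrix `F - Γ h` (`IsStabilizingSol.isMaximalSol`, `IsStabilizingSol.posDef`).
-/

namespace GaussianFeedback

open Filter Topology

variable {k : ℕ}

/-! ### Eigenvectors, powers of stable matrices and Lyapunov equations -/

theorem mem_spectrum_iff_exists_mulVec {A : Matrix (Fin k) (Fin k) ℂ} {μ : ℂ} :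
    μ ∈ spectrum ℂ A ↔ ∃ v ≠ 0, A *ᵥ v = μ • v := by
  rw [mem_spectrum_iff_isRoot_charpoly, IsRoot.def, eval_charpoly,
    ← exists_mulVec_eq_zero_iff]
  simp only [sub_mulVec, sub_eq_zero, scalar_apply, ← smul_one_eq_diagonal, smul_mulVec,
    one_mulVec]
  simp only [eq_comm]

theorem mem_spectrum_iff_exists_vecMul {A : Matrix (Fin k) (Fin k) ℂ} {μ : ℂ} :
    μ ∈ spectrum ℂ A ↔ ∃ v ≠ 0, v ᵥ* A = μ • v := by
  rw [mem_spectrum_iff_isRoot_charpoly, ← charpoly_transpose,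
    ← mem_spectrum_iff_isRoot_charpoly, mem_spectrum_iff_exists_mulVec]
  simp only [mulVec_transpose]

/-- A nonzero space of row vectors that is invariant under a complex matrix contains a left
eigenvector. -/
theorem exists_left_eigenvector_mem (A : Matrix (Fin k) (Fin k) ℂ)
    (V : Submodule ℂ (Fin k → ℂ)) (hV : ∀ v ∈ V, v ᵥ* A ∈ V) (hne : V ≠ ⊥) :
    ∃ v ∈ V, v ≠ 0 ∧ ∃ μ : ℂ, v ᵥ* A = μ • v := by
  have hV' : ∀ v ∈ V, A.vecMulLinear v ∈ V := hV
  have : Nontrivial V := Submodule.nontrivial_iff_ne_bot.mpr hne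
  obtain ⟨μ, hμ⟩ := Module.End.exists_eigenvalue (A.vecMulLinear.restrict hV')
  obtain ⟨v, hv⟩ := hμ.exists_hasEigenvector
  refine ⟨v, v.2, fun h => hv.2 (Subtype.ext h), μ, ?_⟩
  simpa using congrArg Subtype.val hv.apply_eq_smul

section Powers

attribute [local instance] Matrix.linftyOpNormedRing Matrix.linftyOpNormedAlgebra

theorem tendsto_pow_zero_of_spectrum {A : Matrix (Fin k) (Fin k) ℂ}
    (hA : ∀ μ ∈ spectrum ℂ A, ‖μ‖ < 1) : Tendsto (fun n : ℕ => A ^ n) atTop (𝓝 0) := by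
  rcases subsingleton_or_nontrivial (Matrix (Fin k) (Fin k) ℂ) with hs | hs
  · exact tendsto_const_nhds.congr fun n => Subsingleton.elim _ _
  have : CompleteSpace (Matrix (Fin k) (Fin k) ℂ) := FiniteDimensional.complete ℂ _
  have h1 : spectralRadius ℂ A < ((1 : NNReal) : ENNReal) :=
    spectrum.spectralRadius_lt_of_forall_lt A fun z hz => by exact_mod_cast hA z hz
  obtain ⟨c, hc1, hc2⟩ := ENNReal.lt_iff_exists_nnreal_btwn.mp h1
  have h2 := (spectrum.pow_nnnorm_pow_one_div_tendsto_nhds_spectralRadius A).eventually_lt_const hc1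
  have hc : (c : ℝ) < 1 := by exact_mod_cast hc2
  refine squeeze_zero_norm' ?_ (tendsto_pow_atTop_nhds_zero_of_lt_one c.2 hc)
  filter_upwards [h2, eventually_gt_atTop 0] with n hn hn0
  have hn0' : (0 : ℝ) < n := by exact_mod_cast hn0
  have h3 := ENNReal.rpow_le_rpow hn.le hn0'.le
  rw [← ENNReal.rpow_mul, one_div, inv_mul_cancel₀ hn0'.ne', ENNReal.rpow_one,
    ENNReal.rpow_natCast] at h3
  exact_mod_cast h3

end Powers

/-- The powers of a matrix with all eigenvalues in the open unit disc tend to zero. -/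
theorem tendsto_pow_zero {M : Matrix (Fin k) (Fin k) ℝ}
    (hM : ∀ μ ∈ eigenvaluesC M, ‖μ‖ < 1) : Tendsto (fun n : ℕ => M ^ n) atTop (𝓝 0) := by
  have h := tendsto_pow_zero_of_spectrum hM
  have hre : Continuous fun A : Matrix (Fin k) (Fin k) ℂ => A.map Complex.re :=
    continuous_id.matrix_map Complex.continuous_re
  have hlim := (hre.tendsto 0).comp h
  rw [Matrix.map_zero _ Complex.zero_re] at hlim
  refine hlim.congr fun n => ?_
  have : M.map (algebraMap ℝ ℂ) ^ n = (M ^ n).map (algebraMap ℝ ℂ) :=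
    (map_pow (algebraMap ℝ ℂ).mapMatrix M n).symm
  rw [Function.comp_apply, this]
  ext i j
  simp

theorem eigenvaluesC_transpose (M : Matrix (Fin k) (Fin k) ℝ) :
    eigenvaluesC Mᵀ = eigenvaluesC M := by
  ext μ
  simp only [eigenvaluesC, transpose_map, mem_spectrum_iff_isRoot_charpoly, charpoly_transpose]

theorem tendsto_pow_mulVec_zero {M : Matrix (Fin k) (Fin k) ℝ}
    (hM : ∀ μ ∈ eigenvaluesC M, ‖μ‖ < 1) (v : Fin k → ℝ) :
    Tendsto (fun n : ℕ => M ^ n *ᵥ v) atTop (𝓝 0) := by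
  have := (Continuous.matrix_mulVec continuous_id (continuous_const (y := v))).tendsto
    (0 : Matrix (Fin k) (Fin k) ℝ) |>.comp (tendsto_pow_zero hM)
  simpa [Function.comp_def] using this

/-- A symmetric solution of a discrete Lyapunov equation with stable matrix and positive
semidefinite right-hand side is positive semidefinite: its quadratic form increases when the
argument is replaced by its image under the transposed matrix, and the orbit tends to zero. -/
theorem posSemidef_of_lyapunov {M D Q : Matrix (Fin k) (Fin k) ℝ}
    (hM : ∀ μ ∈ eigenvaluesC M, ‖μ‖ < 1) (hD : D.IsSymm) (hQ : Q.PosSemidef)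
    (h : D = M * D * Mᵀ + Q) : D.PosSemidef := by
  refine .of_dotProduct_mulVec_nonneg 
    (by rwa [IsHermitian, conjTranspose_eq_transpose_of_trivial]) fun x => ?_
  have hstep : ∀ y : Fin k → ℝ, (Mᵀ *ᵥ y) ⬝ᵥ (D *ᵥ (Mᵀ *ᵥ y)) ≤ y ⬝ᵥ (D *ᵥ y) := by
    intro y
    have h0 : y ⬝ᵥ (D *ᵥ y) = y ⬝ᵥ ((M * D * Mᵀ + Q) *ᵥ y) := by rw [← h]
    have h1 := hQ.dotProduct_mulVec_nonneg y
    rw [star_trivial] at h1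
    rw [h0, add_mulVec, dotProduct_add, ← mulVec_mulVec, ← mulVec_mulVec, dotProduct_mulVec y M,
      ← mulVec_transpose]
    linarith
  have hle : ∀ n : ℕ, (Mᵀ ^ n *ᵥ x) ⬝ᵥ (D *ᵥ (Mᵀ ^ n *ᵥ x)) ≤ x ⬝ᵥ (D *ᵥ x) := by
    intro n
    induction n with
    | zero => simp
    | succ n ih =>
      rw [pow_succ', ← mulVec_mulVec]
      exact (hstep _).trans ih
  have hlim := tendsto_pow_mulVec_zero (M := Mᵀ) (by rwa [eigenvaluesC_transpose]) x
  have hcont : Continuous fun y : Fin k → ℝ => y ⬝ᵥ (D *ᵥ y) := by fun_prop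
  have := (hcont.tendsto 0).comp hlim
  simp only [zero_dotProduct] at this
  exact le_of_tendsto this (Eventually.of_forall hle)

theorem eq_zero_of_eq_conj {M A : Matrix (Fin k) (Fin k) ℝ}
    (hM : ∀ μ ∈ eigenvaluesC M, ‖μ‖ < 1) (h : A = Mᵀ * A * M) : A = 0 := by
  have hn : ∀ n : ℕ, A = (M ^ n)ᵀ * A * M ^ n := by
    intro n
    induction n with
    | zero => simp
    | succ n ih =>
      rw [pow_succ', transpose_mul]
      calc A = (M ^ n)ᵀ * A * M ^ n := ih
        _ = (M ^ n)ᵀ * (Mᵀ * A * M) * M ^ n := by rw [← h]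
        _ = _ := by simp only [Matrix.mul_assoc]
  have hcont : Continuous fun N : Matrix (Fin k) (Fin k) ℝ => Nᵀ * A * N := by fun_prop
  have hlim := (hcont.tendsto 0).comp (tendsto_pow_zero hM)
  have h0 : Tendsto (fun _ : ℕ => A) atTop (𝓝 ((0 : Matrix (Fin k) (Fin k) ℝ)ᵀ * A * 0)) :=
    hlim.congr fun n => (hn n).symm
  simpa using tendsto_nhds_unique tendsto_const_nhds h0

/-- The Lyapunov equation of a stable matrix is solvable; the solution is symmetric because it
is unique. -/
theorem exists_lyapunov {M : Matrix (Fin k) (Fin k) ℝ} (hM : ∀ μ ∈ eigenvaluesC M, ‖μ‖ < 1)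
    {Q : Matrix (Fin k) (Fin k) ℝ} (hQ : Q.IsSymm) :
    ∃ A : Matrix (Fin k) (Fin k) ℝ, A.IsSymm ∧ A = Mᵀ * A * M + Q := by
  let Φ : Matrix (Fin k) (Fin k) ℝ →ₗ[ℝ] Matrix (Fin k) (Fin k) ℝ :=
    { toFun := fun A => A - Mᵀ * A * M
      map_add' := fun A B => by simp only [Matrix.mul_add, Matrix.add_mul]; abel
      map_smul' := fun c A => by simp [smul_sub] }
  have hinj : Function.Injective Φ :=
    (injective_iff_map_eq_zero Φ).mpr fun A hA => eq_zero_of_eq_conj hM (sub_eq_zero.mp hA)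
  obtain ⟨A, hA⟩ := LinearMap.surjective_of_injective hinj Q
  have hA' : A - Mᵀ * A * M = Q := hA
  refine ⟨A, hinj ?_, by rw [← hA']; abel⟩
  change Aᵀ - Mᵀ * Aᵀ * M = A - Mᵀ * A * M
  rw [hA', ← hQ.eq, ← hA']
  simp [Matrix.mul_assoc]

theorem isSymm_vecMulVec_self (v : Fin k → ℝ) : (vecMulVec v v).IsSymm :=
  transpose_vecMulVec v v

theorem posSemidef_smul_vecMulVec_self {c : ℝ} (hc : 0 ≤ c) (v : Fin k → ℝ) :
    (c • vecMulVec v v).PosSemidef := by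
  simpa using (posSemidef_vecMulVec_self_star v).smul hc

/-! ### The state matrix -/

theorem aeval_unitPoly (c : Fin k → ℝ) (z : ℂ) :
    aeval z (unitPoly c) = 1 + ∑ i : Fin k, (c i : ℂ) * z ^ ((i : ℕ) + 1) := by
  simp [unitPoly]

/-- For an eigenvector `v` of the companion matrix with eigenvalue `μ ≠ 0` the subdiagonal
forces `v i = μ⁻¹ ^ i * v 0`, and the first row says that `μ⁻¹` is a zero of `unitPoly q`. -/
theorem stateF_stable {q : Fin k → ℝ} (hq : IsStablePoly (unitPoly q)) :
    ∀ μ ∈ eigenvaluesC (stateF q), ‖μ‖ < 1 := by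
  intro μ hμ
  obtain ⟨v, hv0, hv⟩ := mem_spectrum_iff_exists_mulVec.mp hμ
  by_cases hμ0 : μ = 0
  · simp [hμ0]
  rcases k with _ | k
  · exact absurd (Subsingleton.elim _ _) hv0
  have hrow : ∀ i : Fin k, v i.castSucc = μ * v i.succ := by
    intro i
    have := congrFun hv i.succ
    rw [mulVec, dotProduct, Finset.sum_eq_single i.castSucc] at this
    · simpa [stateF] using this
    · intro j _ hj
      have : (i : ℕ) ≠ j := fun h => hj (Fin.ext h.symm)
      simp [stateF, this]
    · simp
  have hpow : ∀ n (hn : n < k + 1), v ⟨n, hn⟩ = μ⁻¹ ^ n * v 0 := by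
    intro n
    induction n with
    | zero => intro hn; simp
    | succ n ih =>
      intro hn
      have h1 := ih (by omega)
      have h2 := hrow ⟨n, by omega⟩
      simp only [Fin.castSucc_mk, Fin.succ_mk] at h2
      rw [pow_succ', mul_assoc, ← h1, h2, inv_mul_cancel_left₀ hμ0]
  have hv00 : v 0 ≠ 0 := by
    intro h
    exact hv0 (funext fun i => by rw [hpow i i.2, h]; simp)
  have h0 := congrFun hv 0
  simp only [mulVec, dotProduct, stateF, map_apply, of_apply, Fin.val_zero, if_true,
    Pi.smul_apply, smul_eq_mul] at h0
  have hroot : aeval μ⁻¹ (unitPoly q) = 0 := by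
    rw [aeval_unitPoly]
    have : (μ * v 0) * (1 + ∑ i : Fin (k + 1), (q i : ℂ) * μ⁻¹ ^ ((i : ℕ) + 1)) = 0 := by
      rw [mul_add, mul_one, ← h0, Finset.mul_sum, ← Finset.sum_add_distrib]
      refine Finset.sum_eq_zero fun i _ => ?_
      rw [hpow i i.2, h0, pow_succ]
      simp only [map_neg, Complex.coe_algebraMap]
      field_simp
      ring
    exact (mul_eq_zero.mp this).resolve_left (mul_ne_zero hμ0 hv00)
  have := hq _ hroot
  rw [norm_inv] at this
  exact (one_lt_inv₀ (norm_pos_iff.mpr hμ0)).mp this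

/-- The pair `(F, G)` is controllable: no left eigenvector of `F` is orthogonal to `G`. -/
theorem stateF_controllable (q : Fin k → ℝ) {v : Fin k → ℂ} {μ : ℂ}
    (hv : v ᵥ* (stateF q).map (algebraMap ℝ ℂ) = μ • v)
    (hG : v ⬝ᵥ (algebraMap ℝ ℂ ∘ inputG k) = 0) : v = 0 := by
  rcases k with _ | k
  · exact Subsingleton.elim _ _
  have hv0 : v 0 = 0 := by
    rw [dotProduct, Finset.sum_eq_single 0] at hG
    · simpa [inputG] using hG
    · intro j _ hj
      have : (j : ℕ) ≠ 0 := fun h => hj (Fin.ext h)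
      simp [inputG, hj]
    · simp
  have hstep : ∀ i : Fin k, v i.succ = μ * v i.castSucc := by
    intro i
    have := congrFun hv i.castSucc
    rw [vecMul, dotProduct, Finset.sum_eq_single i.succ] at this
    · simpa [stateF] using this
    · intro j _ hj
      by_cases hj0 : j = 0
      · simp [hj0, hv0]
      have h1 : (j : ℕ) ≠ 0 := fun h => hj0 (Fin.ext h)
      have h2 : (j : ℕ) ≠ i + 1 := fun h => hj (Fin.ext h)
      simp [stateF, hj0, h2]
    · simp
  have : ∀ n (hn : n < k + 1), v ⟨n, hn⟩ = 0 := by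
    intro n
    induction n with
    | zero => intro hn; exact hv0
    | succ n ih =>
      intro hn
      have h2 := hstep ⟨n, by omega⟩
      simp only [Fin.castSucc_mk, Fin.succ_mk] at h2
      rw [h2, ih (by omega), mul_zero]
  exact funext fun i => this i i.2

/-! ### Riccati and Lyapunov identities -/

/-- The quadratic expansion of `(M - g h') T (M - g h')'`. -/
theorem sub_vecMulVec_conj (M T : Matrix (Fin k) (Fin k) ℝ) (hT : T.IsSymm) (g h : Fin k → ℝ) :
    (M - vecMulVec g h) * T * (M - vecMulVec g h)ᵀ =
      M * T * Mᵀ - vecMulVec g (M *ᵥ (T *ᵥ h)) - vecMulVec (M *ᵥ (T *ᵥ h)) g +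
        (h ⬝ᵥ (T *ᵥ h)) • vecMulVec g g := by
  have hTh : h ᵥ* T = T *ᵥ h := by rw [← mulVec_transpose, hT.eq]
  rw [transpose_sub, transpose_vecMulVec, Matrix.sub_mul, Matrix.mul_sub, Matrix.sub_mul,
    Matrix.sub_mul, vecMulVec_mul, hTh, mul_vecMulVec, vecMulVec_mul, vecMulVec_mul_vecMulVec,
    vecMul_transpose, ← mulVec_mulVec, dotProduct_comm (T *ᵥ h)]
  ext i j
  simp [vecMulVec_apply]
  ring

theorem innovVar_smul_gain {F : Matrix (Fin k) (Fin k) ℝ} {G h : Fin k → ℝ}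
    {T : Matrix (Fin k) (Fin k) ℝ} (hψ : innovVar h T ≠ 0) :
    F *ᵥ (T *ᵥ h) = innovVar h T • gain F G h T - G := by
  rw [gain, smul_inv_smul₀ hψ, add_sub_cancel_right]

/-- A solution of the Riccati equation satisfies a perturbed Lyapunov equation for every choice
`g` of the observer gain (the Joseph form); the perturbation vanishes at the optimal gain. -/
theorem IsDARESol.joseph {F : Matrix (Fin k) (Fin k) ℝ} {G h : Fin k → ℝ}
    {T : Matrix (Fin k) (Fin k) ℝ} (hT : IsDARESol F G h T) (g : Fin k → ℝ) :
    T = (F - vecMulVec g h) * T * (F - vecMulVec g h)ᵀ + vecMulVec (G - g) (G - g) -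
      innovVar h T • vecMulVec (gain F G h T - g) (gain F G h T - g) := by
  have hψ := hT.denom_ne
  have hu : h ⬝ᵥ (T *ᵥ h) = innovVar h T - 1 := by simp [innovVar]
  have h1 := hT.eq
  rw [sub_vecMulVec_conj _ _ hT.symm, hu]
  rw [innovVar_smul_gain (F := F) (G := G) hψ] at h1 ⊢
  ext i j
  have h2 := congrFun (congrFun h1 i) j
  simp [vecMulVec_apply] at h2 ⊢
  field_simp at h2
  linear_combination h2

theorem isDARESol_zero (F : Matrix (Fin k) (Fin k) ℝ) (G h : Fin k → ℝ) :
    IsDARESol F G h 0 :=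
  ⟨isSymm_zero, by simp [innovVar], by simp [innovVar]⟩

theorem one_le_innovVar {T : Matrix (Fin k) (Fin k) ℝ} (hT : T.PosSemidef) (h : Fin k → ℝ) :
    1 ≤ innovVar h T := by
  have := hT.dotProduct_mulVec_nonneg h
  rw [star_trivial] at this
  rw [innovVar]
  linarith

section Stabilizing

variable {F : Matrix (Fin k) (Fin k) ℝ} {G h : Fin k → ℝ} {S : Matrix (Fin k) (Fin k) ℝ}

theorem IsDARESol.lyapunov (hS : IsDARESol F G h S) :
    S = (F - vecMulVec (gain F G h S) h) * S * (F - vecMulVec (gain F G h S) h)ᵀ +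
      vecMulVec (G - gain F G h S) (G - gain F G h S) := by
  simpa using hS.joseph (gain F G h S)

/-- The closed loop matrix `F - Γ h` and the antistable matrix `F - G h` are intertwined by the
solution: `S = (F - Γ h) S (F - G h)'`. -/
theorem IsDARESol.eq_mul_mul_transpose (hS : IsDARESol F G h S) :
    S = (F - vecMulVec (gain F G h S) h) * S * (F - vecMulVec G h)ᵀ := by
  have hu : h ⬝ᵥ (S *ᵥ h) = innovVar h S - 1 := by simp [innovVar]
  have hcl : (F - vecMulVec (gain F G h S) h) *ᵥ (S *ᵥ h) = gain F G h S - G := by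
    rw [sub_mulVec, vecMulVec_mulVec, innovVar_smul_gain (F := F) (G := G) hS.denom_ne, hu]
    ext i
    simp
    ring
  have hE : (F - vecMulVec G h)ᵀ =
      (F - vecMulVec (gain F G h S) h)ᵀ - vecMulVec h (G - gain F G h S) := by
    simp only [transpose_sub, transpose_vecMulVec, vecMulVec_sub]
    abel
  rw [hE, Matrix.mul_sub, mul_vecMulVec, ← mulVec_mulVec, hcl, ← neg_sub G, neg_vecMulVec,
    sub_neg_eq_add]
  exact hS.lyapunov

theorem IsStabilizingSol.posSemidef (hS : IsStabilizingSol F G h S) : S.PosSemidef :=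
  posSemidef_of_lyapunov hS.stable hS.sol.symm
    (by simpa using posSemidef_vecMulVec_self_star (G - gain F G h S)) hS.sol.lyapunov

/-- A stabilizing solution is maximal. The difference to another solution `T` solves a Lyapunov
equation whose right-hand side has the sign of `innovVar h T`; a negative sign would give
`T ≥ S ≥ 0`, hence `innovVar h T ≥ 1`. -/
theorem IsStabilizingSol.isMaximalSol (hS : IsStabilizingSol F G h S) : IsMaximalSol F G h S := by
  refine ⟨hS.sol, fun T hT => ?_⟩
  set Γ := gain F G h S with hΓ
  have hST : S - T = (F - vecMulVec Γ h) * (S - T) * (F - vecMulVec Γ h)ᵀ +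
      innovVar h T • vecMulVec (gain F G h T - Γ) (gain F G h T - Γ) := by
    rw [Matrix.mul_sub, Matrix.sub_mul]
    nth_rewrite 1 [hS.sol.lyapunov, hT.joseph Γ]
    abel
  have hpos : 0 ≤ innovVar h T := by
    by_contra! hneg
    have hTS : (T - S).PosSemidef := by
      refine posSemidef_of_lyapunov hS.stable (hT.symm.sub hS.sol.symm)
        (posSemidef_smul_vecMulVec_self (neg_nonneg.mpr hneg.le) (gain F G h T - Γ)) ?_
      rw [← neg_sub S T, Matrix.mul_neg, Matrix.neg_mul, neg_smul]
      nth_rewrite 1 [hST]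
      abel
    have := one_le_innovVar (by simpa using hTS.add hS.posSemidef : T.PosSemidef) h
    linarith
  exact posSemidef_of_lyapunov hS.stable (hS.sol.symm.sub hT.symm)
    (posSemidef_smul_vecMulVec_self hpos _) hST

/-- If `F - G h` has all eigenvalues outside the closed unit disc, a stabilizing solution is
positive definite: `(F - Γ h)'` and `(F - G h)'` agree on the kernel of `S` and leave it
invariant, but the orbits of the first tend to zero and those of the second do not. -/
theorem IsStabilizingSol.posDef (hS : IsStabilizingSol F G h S)
    (hE : ∀ μ ∈ eigenvaluesC (F - vecMulVec G h), 1 < ‖μ‖) : S.PosDef := by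
  set Γ := gain F G h S with hΓ
  set Fc := F - vecMulVec Γ h with hFc
  set E := F - vecMulVec G h with hEdef
  have hker : ∀ x, S *ᵥ x = 0 → S *ᵥ (Fcᵀ *ᵥ x) = 0 ∧ Eᵀ *ᵥ x = Fcᵀ *ᵥ x := by
    intro x hx
    have h0 : x ⬝ᵥ (S *ᵥ x) = 0 := by rw [hx, dotProduct_zero]
    rw [hS.sol.lyapunov, ← hΓ, ← hFc, add_mulVec, dotProduct_add, ← mulVec_mulVec,
      ← mulVec_mulVec, dotProduct_mulVec x Fc, ← mulVec_transpose, vecMulVec_mulVec,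
      op_smul_eq_smul, dotProduct_smul, smul_eq_mul, dotProduct_comm x] at h0
    have h1 := hS.posSemidef.dotProduct_mulVec_nonneg (Fcᵀ *ᵥ x)
    rw [star_trivial] at h1
    have h2 : (G - Γ) ⬝ᵥ x = 0 := by nlinarith [mul_self_nonneg ((G - Γ) ⬝ᵥ x)]
    have h3 : (Fcᵀ *ᵥ x) ⬝ᵥ (S *ᵥ (Fcᵀ *ᵥ x)) = 0 := by
      rw [h2] at h0
      simpa using h0
    refine ⟨(hS.posSemidef.dotProduct_mulVec_zero_iff _).mp (by rwa [star_trivial]), ?_⟩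
    have : Eᵀ = Fcᵀ - vecMulVec h (G - Γ) := by
      simp only [hEdef, hFc, transpose_sub, transpose_vecMulVec, vecMulVec_sub]
      abel
    rw [this, sub_mulVec, vecMulVec_mulVec, h2]
    simp
  have hEt : ∀ μ ∈ eigenvaluesC Eᵀ, 1 < ‖μ‖ := by rwa [eigenvaluesC_transpose]
  have hunit : IsUnit Eᵀ.det := by
    rw [isUnit_iff_ne_zero]
    intro h0
    obtain ⟨v, hv, hv0⟩ := exists_mulVec_eq_zero_iff.mpr
      (show (Eᵀ.map (algebraMap ℝ ℂ)).det = 0 by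
        rw [← RingHom.mapMatrix_apply, ← RingHom.map_det, h0, map_zero])
    have := hEt 0 (mem_spectrum_iff_exists_mulVec.mpr ⟨v, hv, by rw [hv0, zero_smul]⟩)
    simp at this
    linarith
  have hinv : ∀ μ ∈ eigenvaluesC (Eᵀ)⁻¹, ‖μ‖ < 1 := by
    intro μ hμ
    obtain ⟨w, hw0, hw⟩ := mem_spectrum_iff_exists_mulVec.mp hμ
    have hw' : w = μ • (Eᵀ.map (algebraMap ℝ ℂ) *ᵥ w) := by
      have : Eᵀ.map (algebraMap ℝ ℂ) * (Eᵀ)⁻¹.map (algebraMap ℝ ℂ) = 1 := by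
        rw [← Matrix.map_mul, mul_nonsing_inv _ hunit]
        simp
      rw [← mulVec_smul, ← hw, mulVec_mulVec, this, one_mulVec]
    have hμ0 : μ ≠ 0 := by
      rintro rfl
      exact hw0 (by rw [hw', zero_smul])
    have := hEt μ⁻¹ (mem_spectrum_iff_exists_mulVec.mpr ⟨w, hw0, by
      rw [eq_inv_smul_iff₀ hμ0, ← hw']⟩)
    rw [norm_inv] at this
    exact (one_lt_inv₀ (norm_pos_iff.mpr hμ0)).mp this
  have hzero : ∀ x, S *ᵥ x = 0 → x = 0 := by
    intro x hx
    have hn : ∀ n : ℕ, S *ᵥ (Fcᵀ ^ n *ᵥ x) = 0 ∧ Eᵀ⁻¹ ^ n *ᵥ (Fcᵀ ^ n *ᵥ x) = x := by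
      intro n
      induction n with
      | zero => simpa using hx
      | succ n ih =>
        rw [pow_succ' Fcᵀ, ← mulVec_mulVec]
        refine ⟨(hker _ ih.1).1, ?_⟩
        rw [← (hker _ ih.1).2, mulVec_mulVec, pow_succ, Matrix.mul_assoc,
          nonsing_inv_mul _ hunit, Matrix.mul_one, ih.2]
    have h1 := tendsto_pow_zero hinv
    have h2 := tendsto_pow_mulVec_zero (M := Fcᵀ) (by
      rw [eigenvaluesC_transpose]; exact hS.stable) x
    have hcont : Continuous fun y : Matrix (Fin k) (Fin k) ℝ × (Fin k → ℝ) => y.1 *ᵥ y.2 :=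
      continuous_fst.matrix_mulVec continuous_snd
    have h3 := (hcont.tendsto (0, 0)).comp (h1.prodMk_nhds h2)
    rw [zero_mulVec] at h3
    exact tendsto_nhds_unique (tendsto_const_nhds.congr fun n => ((hn n).2).symm) h3
  refine .of_dotProduct_mulVec_pos hS.posSemidef.1 fun x hx => ?_
  refine lt_of_le_of_ne (hS.posSemidef.dotProduct_mulVec_nonneg x) fun h0 => hx (hzero x ?_)
  exact (hS.posSemidef.dotProduct_mulVec_zero_iff x).mp h0.symm

/-- Spectral reflection: the closed loop matrix has the reciprocals of the eigenvalues of
`F - G h` as eigenvalues. -/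
theorem IsDARESol.inv_mem_eigenvaluesC (hS : IsDARESol F G h S) (hpd : S.PosDef) {α : ℂ}
    (hα : α ∈ eigenvaluesC (F - vecMulVec G h)) (hα0 : α ≠ 0) :
    α⁻¹ ∈ eigenvaluesC (F - vecMulVec (gain F G h S) h) := by
  rw [← eigenvaluesC_transpose] at hα
  obtain ⟨w, hw0, hw⟩ := mem_spectrum_iff_exists_mulVec.mp hα
  have hmap := congrArg (fun M => M.map (algebraMap ℝ ℂ)) hS.eq_mul_mul_transpose
  simp only [Matrix.map_mul] at hmap
  refine mem_spectrum_iff_exists_mulVec.mpr ⟨S.map (algebraMap ℝ ℂ) *ᵥ w, fun h0 => hw0 ?_, ?_⟩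
  · have hdet : (S.map (algebraMap ℝ ℂ)).det ≠ 0 := by
      rw [← RingHom.mapMatrix_apply, ← RingHom.map_det]
      simpa using hpd.det_pos.ne'
    exact eq_zero_of_mulVec_eq_zero hdet h0
  · rw [eq_inv_smul_iff₀ hα0, ← mulVec_smul, ← mulVec_smul, ← hw, mulVec_mulVec, mulVec_mulVec,
      ← hmap]

end Stabilizing

/-! ### The dual certificate -/

/-- A dual certificate of optimality: a symmetric matrix `A` and multipliers `ν`, `μ` such that,
for every state `x` and every input `y`,
`|F x + g y|²_A - |x|²_A + ν (h x + y)² - μ (H x + y)² + y² = 0`,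
where `|x|²_A = x' A x`. The fields are the coefficients of this quadratic form in `(x, y)`. -/
structure IsDualCertificate (F : Matrix (Fin k) (Fin k) ℝ) (g h H : Fin k → ℝ)
    (A : Matrix (Fin k) (Fin k) ℝ) (ν μ : ℝ) : Prop where
  symm : A.IsSymm
  state : A = Fᵀ * A * F + ν • vecMulVec h h - μ • vecMulVec H H
  cross : Fᵀ *ᵥ (A *ᵥ g) + ν • h - μ • H = 0
  scalar : g ⬝ᵥ (A *ᵥ g) + ν - μ + 1 = 0

namespace IsDualCertificate

variable {F : Matrix (Fin k) (Fin k) ℝ} {g h H : Fin k → ℝ} {A : Matrix (Fin k) (Fin k) ℝ}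
  {ν μ : ℝ}

/-- The certificate identity after the feedback `y = -c x`. -/
theorem feedback (hA : IsDualCertificate F g h H A ν μ) (c : Fin k → ℝ) :
    A = (F - vecMulVec g c)ᵀ * A * (F - vecMulVec g c) + ν • vecMulVec (h - c) (h - c) -
      μ • vecMulVec (H - c) (H - c) + vecMulVec c c := by
  have h1 := sub_vecMulVec_conj Fᵀ A hA.symm c g
  rw [← transpose_vecMulVec g c, ← transpose_sub, transpose_transpose] at h1
  have h2 : Fᵀ *ᵥ (A *ᵥ g) = μ • H - ν • h := by
    rw [← sub_eq_zero, ← hA.cross]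
    abel
  have h3 : g ⬝ᵥ (A *ᵥ g) = μ - ν - 1 := by linarith [hA.scalar]
  rw [h1, h2, h3, transpose_transpose]
  ext i j
  have h4 := congrFun (congrFun hA.state i) j
  simp [vecMulVec_apply] at h4 ⊢
  linear_combination h4

/-- The matrix of the certificate is positive semidefinite: the feedback `y = -H x` removes the
negative term, so that the identity becomes a Lyapunov equation for `F - g H`. -/
theorem posSemidef (hA : IsDualCertificate F g h H A ν μ) (hν : 0 ≤ ν)
    (hstab : ∀ z ∈ eigenvaluesC (F - vecMulVec g H), ‖z‖ < 1) : A.PosSemidef := by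
  refine posSemidef_of_lyapunov (M := (F - vecMulVec g H)ᵀ)
    (by rwa [eigenvaluesC_transpose]) hA.symm
    ((posSemidef_smul_vecMulVec_self hν (h - H)).add
      (posSemidef_smul_vecMulVec_self zero_le_one H)) ?_
  have := hA.feedback H
  rw [sub_self, vecMulVec_zero, smul_zero, sub_zero] at this
  rwa [transpose_transpose, one_smul, ← add_assoc]

/-- Pairing the certificate with an arbitrary solution `T` of a Riccati equation. -/
theorem innovVar_eq (hA : IsDualCertificate F g h H A ν μ) {G c : Fin k → ℝ}
    {T : Matrix (Fin k) (Fin k) ℝ} (hT : IsDARESol F G c T) :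
    innovVar c T = 1 + (G - g) ⬝ᵥ (A *ᵥ (G - g)) + μ * ((H - c) ⬝ᵥ (T *ᵥ (H - c))) -
      ν * ((h - c) ⬝ᵥ (T *ᵥ (h - c))) -
      innovVar c T * ((gain F G c T - g) ⬝ᵥ (A *ᵥ (gain F G c T - g))) := by
  have htr : ∀ (M : Matrix (Fin k) (Fin k) ℝ) (v : Fin k → ℝ),
      (M * vecMulVec v v).trace = v ⬝ᵥ (M *ᵥ v) := fun M v => by
    rw [mul_vecMulVec, trace_vecMulVec, dotProduct_comm]
  have htr' : ∀ (M : Matrix (Fin k) (Fin k) ℝ) (v : Fin k → ℝ),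
      (vecMulVec v v * M).trace = v ⬝ᵥ (M *ᵥ v) := fun M v => by
    rw [trace_mul_comm, htr]
  have hcyc : (A * ((F - vecMulVec g c) * T * (F - vecMulVec g c)ᵀ)).trace =
      ((F - vecMulVec g c)ᵀ * A * (F - vecMulVec g c) * T).trace := by
    rw [← Matrix.mul_assoc, trace_mul_comm]
    simp only [Matrix.mul_assoc]
  have h1 := congrArg (fun M => (A * M).trace) (hT.joseph g)
  have h2 := congrArg (fun M => (M * T).trace) (hA.feedback c)
  simp only [Matrix.mul_sub, Matrix.mul_add, Matrix.sub_mul, Matrix.add_mul, trace_sub, trace_add,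
    Matrix.smul_mul, Matrix.mul_smul, trace_smul, smul_eq_mul, htr, htr'] at h1 h2 hcyc
  have h3 : c ⬝ᵥ (T *ᵥ c) = innovVar c T - 1 := by simp [innovVar]
  linarith

end IsDualCertificate

/-! ### Characteristic polynomials of rank one perturbations -/

section Field

variable {K : Type*} [Field K]

theorem det_one_add_vecMulVec (x g : Fin k → K) : (1 + vecMulVec x g).det = 1 + g ⬝ᵥ x := by
  rw [vecMulVec_eq Unit, det_one_add_replicateCol_mul_replicateRow]

/-- If `x = (z - M)⁻¹ b`, then `1 + g x` is the quotient of two characteristic polynomials. -/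
theorem eval_charpoly_sub_vecMulVec {M : Matrix (Fin k) (Fin k) K} {b x : Fin k → K} {z : K}
    (hx : M *ᵥ x + b = z • x) (g : Fin k → K) :
    (M - vecMulVec b g).charpoly.eval z = M.charpoly.eval z * (1 + g ⬝ᵥ x) := by
  rw [eval_charpoly, eval_charpoly, ← det_one_add_vecMulVec, ← det_mul, Matrix.mul_add,
    Matrix.mul_one, mul_vecMulVec, sub_mulVec]
  have : scalar (Fin k) z *ᵥ x = z • x := by
    simp [← smul_one_eq_diagonal, smul_mulVec]
  rw [this, ← hx, add_sub_cancel_left]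
  congr 1
  abel

theorem eval_charpolyRev_eq_det (M : Matrix (Fin k) (Fin k) K) (z : K) :
    M.charpolyRev.eval z = (1 - z • M).det := by
  rw [charpolyRev, ← coe_evalRingHom, RingHom.map_det]
  congr 1
  ext i j
  simp [Matrix.one_apply, apply_ite, mul_comm z]

/-- The counterpart of `eval_charpoly_sub_vecMulVec` at `z⁻¹`. -/
theorem eval_charpolyRev_sub_vecMulVec {M : Matrix (Fin k) (Fin k) K} {b x : Fin k → K} {z : K}
    (hx : z • (M *ᵥ x + b) = x) (g : Fin k → K) :
    (M - vecMulVec b g).charpolyRev.eval z = M.charpolyRev.eval z * (1 + g ⬝ᵥ x) := by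
  rw [eval_charpolyRev_eq_det, eval_charpolyRev_eq_det, ← det_one_add_vecMulVec, ← det_mul,
    Matrix.mul_add, Matrix.mul_one, mul_vecMulVec, sub_mulVec, one_mulVec, smul_mulVec]
  have : x - z • M *ᵥ x = z • b := by
    nth_rewrite 1 [← hx]
    rw [smul_add, add_sub_cancel_left]
  rw [this, smul_vecMulVec, smul_sub]
  congr 1
  abel

theorem exists_resolvent {M : Matrix (Fin k) (Fin k) K} {z : K} (hz : M.charpoly.eval z ≠ 0)
    (b : Fin k → K) : ∃ x, M *ᵥ x + b = z • x := by
  rw [eval_charpoly] at hz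
  refine ⟨(scalar (Fin k) z - M)⁻¹ *ᵥ b, ?_⟩
  have h1 : (scalar (Fin k) z - M) *ᵥ ((scalar (Fin k) z - M)⁻¹ *ᵥ b) = b := by
    rw [mulVec_mulVec, mul_nonsing_inv _ (isUnit_iff_ne_zero.mpr hz), one_mulVec]
  nth_rewrite 2 [← h1]
  rw [sub_mulVec, add_sub_cancel]
  simp [← smul_one_eq_diagonal, smul_mulVec]

theorem exists_resolventRev {M : Matrix (Fin k) (Fin k) K} {z : K}
    (hz : M.charpolyRev.eval z ≠ 0) (b : Fin k → K) : ∃ x, z • (M *ᵥ x + b) = x := by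
  rw [eval_charpolyRev_eq_det] at hz
  refine ⟨(1 - z • M)⁻¹ *ᵥ (z • b), ?_⟩
  have h1 : (1 - z • M) *ᵥ ((1 - z • M)⁻¹ *ᵥ (z • b)) = z • b := by
    rw [mulVec_mulVec, mul_nonsing_inv _ (isUnit_iff_ne_zero.mpr hz), one_mulVec]
  rw [smul_add]
  nth_rewrite 2 [← h1]
  rw [sub_mulVec, one_mulVec, smul_mulVec, add_sub_cancel]

theorem natDegree_charpolyRev_le (M : Matrix (Fin k) (Fin k) K) : M.charpolyRev.natDegree ≤ k := by
  rw [← reverse_charpoly]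
  refine (reverse_natDegree_le _).trans ?_
  simp

theorem charpolyRev_ne_zero (M : Matrix (Fin k) (Fin k) K) : M.charpolyRev ≠ 0 := by
  rw [← reverse_charpoly, Ne, reverse_eq_zero]
  exact (charpoly_monic M).ne_zero

/-- Two polynomials that agree outside the zeros of a third one are equal. -/
theorem eq_of_eval_eq_of_ne_zero [Infinite K] {P Q R : K[X]} (hR : R ≠ 0)
    (h : ∀ z, R.eval z ≠ 0 → P.eval z = Q.eval z) : P = Q := by
  refine mul_left_cancel₀ hR (Polynomial.funext fun z => ?_)
  rw [eval_mul, eval_mul]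
  by_cases hz : R.eval z = 0
  · rw [hz, zero_mul, zero_mul]
  · rw [h z hz]

end Field

/-- If `(M, b)` is controllable, only the zero output row leaves the characteristic polynomial
unchanged. The rows that annihilate the resolvent `(z - M)⁻¹ b` form an invariant space, and are
orthogonal to `b`. -/
theorem eq_zero_of_charpoly_sub_vecMulVec {M : Matrix (Fin k) (Fin k) ℂ} {b r : Fin k → ℂ}
    (hctrl : ∀ (v : Fin k → ℂ) (μ : ℂ), v ᵥ* M = μ • v → v ⬝ᵥ b = 0 → v = 0)
    (h : (M - vecMulVec b r).charpoly = M.charpoly) : r = 0 := by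
  let V : Submodule ℂ (Fin k → ℂ) :=
    { carrier := {v | ∀ z x, M.charpoly.eval z ≠ 0 → M *ᵥ x + b = z • x → v ⬝ᵥ x = 0}
      zero_mem' := fun z x _ _ => zero_dotProduct x
      add_mem' := fun {v w} hv hw z x hz hx => by
        rw [add_dotProduct, hv z x hz hx, hw z x hz hx, add_zero]
      smul_mem' := fun c v hv z x hz hx => by
        rw [smul_dotProduct, hv z x hz hx, smul_zero] }
  have hmul : ∀ v ∈ V, ∀ z x, M.charpoly.eval z ≠ 0 → M *ᵥ x + b = z • x →
      (v ᵥ* M) ⬝ᵥ x = -(v ⬝ᵥ b) := by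
    intro v hv z x hz hx
    have h1 : v ⬝ᵥ (M *ᵥ x + b) = 0 := by rw [hx, dotProduct_smul, hv z x hz hx, smul_zero]
    rw [dotProduct_add, dotProduct_mulVec] at h1
    exact eq_neg_of_add_eq_zero_left h1
  have hb : ∀ v ∈ V, v ⬝ᵥ b = 0 := by
    intro v hv
    have h1 : (M - vecMulVec b (v ᵥ* M)).charpoly = C (1 - v ⬝ᵥ b) * M.charpoly := by
      refine eq_of_eval_eq_of_ne_zero (charpoly_monic M).ne_zero fun z hz => ?_
      obtain ⟨x, hx⟩ := exists_resolvent hz b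
      rw [eval_charpoly_sub_vecMulVec hx, hmul v hv z x hz hx, eval_mul, eval_C]
      ring
    have h2 := congrArg leadingCoeff h1
    rw [leadingCoeff_mul, leadingCoeff_C, (charpoly_monic M).leadingCoeff,
      (charpoly_monic _).leadingCoeff] at h2
    linear_combination h2
  have hbot : V = ⊥ := by
    by_contra hne
    obtain ⟨v, hv, hv0, μ, hvμ⟩ := exists_left_eigenvector_mem M V (fun v hv z x hz hx => by
      rw [hmul v hv z x hz hx, hb v hv, neg_zero]) hne
    exact hv0 (hctrl v μ hvμ (hb v hv))
  have hr : r ∈ V := by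
    intro z x hz hx
    have h1 := eval_charpoly_sub_vecMulVec hx r
    rw [h] at h1
    have h2 : M.charpoly.eval z * (r ⬝ᵥ x) = 0 := by linear_combination -h1
    exact (mul_eq_zero.mp h2).resolve_left hz
  rw [hbot] at hr
  exact (Submodule.mem_bot ℂ).mp hr

/-! ### Spectra and reversed determinants -/

theorem aeval_charpoly (M : Matrix (Fin k) (Fin k) ℝ) (z : ℂ) :
    aeval z M.charpoly = (M.map (algebraMap ℝ ℂ)).charpoly.eval z := by
  rw [charpoly_map, eval_map_algebraMap]

theorem mem_eigenvaluesC_iff {M : Matrix (Fin k) (Fin k) ℝ} {z : ℂ} :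
    z ∈ eigenvaluesC M ↔ aeval z M.charpoly = 0 := by
  rw [eigenvaluesC, mem_spectrum_iff_isRoot_charpoly, aeval_charpoly, IsRoot.def]

theorem aeval_charpolyRev (M : Matrix (Fin k) (Fin k) ℝ) (z : ℂ) :
    aeval z M.charpolyRev = revDet M z := by
  rw [revDet, ← eval_charpolyRev_eq_det, ← eval_map_algebraMap]
  congr 1
  rw [charpolyRev, charpolyRev, ← coe_mapRingHom, RingHom.map_det]
  congr 1
  ext i j
  simp [Matrix.one_apply, apply_ite]

theorem aeval_charpoly_eq_pow_mul {M : Matrix (Fin k) (Fin k) ℝ} {z : ℂ} (hz : z ≠ 0) :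
    aeval z M.charpoly = z ^ k * revDet M z⁻¹ := by
  have := det_smul (1 - z⁻¹ • M.map (algebraMap ℝ ℂ)) z
  rw [Fintype.card_fin] at this
  rw [aeval_charpoly, eval_charpoly, revDet, ← this, smul_sub, smul_inv_smul₀ hz]
  simp [smul_one_eq_diagonal]

theorem revDet_zero (M : Matrix (Fin k) (Fin k) ℝ) : revDet M 0 = 1 := by
  simp [revDet]

theorem revDet_eq_zero_iff {M : Matrix (Fin k) (Fin k) ℝ} {z : ℂ} (hz : z ≠ 0) :
    revDet M z = 0 ↔ z⁻¹ ∈ eigenvaluesC M := by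
  rw [mem_eigenvaluesC_iff, aeval_charpoly_eq_pow_mul (inv_ne_zero hz), inv_inv]
  simp [hz]

theorem revDet_one (M : Matrix (Fin k) (Fin k) ℝ) : revDet M 1 = ((1 - M).det : ℝ) := by
  have h1 : (1 : Matrix (Fin k) (Fin k) ℂ) - M.map (algebraMap ℝ ℂ) =
      (algebraMap ℝ ℂ).mapMatrix (1 - M) := by
    rw [map_sub, map_one, RingHom.mapMatrix_apply]
  rw [revDet, one_smul, h1, ← RingHom.map_det, Complex.coe_algebraMap]

theorem isCoprime_charpoly_charpolyRev {M : Matrix (Fin k) (Fin k) ℝ}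
    (hM : ∀ μ ∈ eigenvaluesC M, ‖μ‖ < 1) : IsCoprime M.charpoly M.charpolyRev := by
  refine (Polynomial.isCoprime_iff_aeval_ne_zero_of_isAlgClosed ℝ ℂ _ _).mpr ?_
  intro a
  by_contra! h
  obtain ⟨h1, h2⟩ := h
  have h3 := hM a (mem_eigenvaluesC_iff.mpr h1)
  rw [aeval_charpolyRev] at h2
  have ha : a ≠ 0 := by
    rintro rfl
    rw [revDet_zero] at h2
    exact one_ne_zero h2
  have h4 := hM _ ((revDet_eq_zero_iff ha).mp h2)
  rw [norm_inv] at h4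
  exact absurd ((inv_lt_one₀ (norm_pos_iff.mpr ha)).mp h4) h3.not_gt

/-! ### Existence of the certificate -/

/-- The numerator of `ν |1 + h x_z|² - μ |1 + H x_z|² + 1`, where `x_z = (z - F)⁻¹ g` and `|·|²`
stands for the product of the values at `z` and `z⁻¹`. -/
noncomputable def spectralGap (F : Matrix (Fin k) (Fin k) ℝ) (g h H : Fin k → ℝ) (ν μ : ℝ) :
    ℝ[X] :=
  C ν * ((F - vecMulVec g h).charpoly * (F - vecMulVec g h).charpolyRev) -
    C μ * ((F - vecMulVec g H).charpoly * (F - vecMulVec g H).charpolyRev) +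
    F.charpoly * F.charpolyRev

theorem natDegree_spectralGap_le (F : Matrix (Fin k) (Fin k) ℝ) (g h H : Fin k → ℝ) (ν μ : ℝ) :
    (spectralGap F g h H ν μ).natDegree ≤ 2 * k := by
  have h1 : ∀ M : Matrix (Fin k) (Fin k) ℝ, (M.charpoly * M.charpolyRev).natDegree ≤ 2 * k := by
    intro M
    refine natDegree_mul_le.trans ?_
    have := natDegree_charpolyRev_le M
    rw [charpoly_natDegree_eq_dim, Fintype.card_fin]
    omega
  have h2 := natDegree_sub_le_of_le
    ((natDegree_C_mul_le ν _).trans (h1 (F - vecMulVec g h)))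
    ((natDegree_C_mul_le μ _).trans (h1 (F - vecMulVec g H)))
  rw [max_self] at h2
  exact natDegree_add_le_of_degree_le h2 (h1 F)

theorem aeval_spectralGap (F : Matrix (Fin k) (Fin k) ℝ) (g h H : Fin k → ℝ) (ν μ : ℝ) {z : ℂ}
    (hz : z ≠ 0) :
    aeval z (spectralGap F g h H ν μ) = z ^ k *
      (ν * (revDet (F - vecMulVec g h) z * revDet (F - vecMulVec g h) z⁻¹) -
        μ * (revDet (F - vecMulVec g H) z * revDet (F - vecMulVec g H) z⁻¹) +
        revDet F z * revDet F z⁻¹) := by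
  simp only [spectralGap, map_add, map_sub, map_mul, aeval_C, aeval_charpolyRev,
    aeval_charpoly_eq_pow_mul hz, Complex.coe_algebraMap]
  ring

/-- If `A` solves the Lyapunov equation of the certificate, the spectral gap only involves the
residuals `r` and `ρ` of the two remaining equations. -/
theorem spectralGap_eq {F A : Matrix (Fin k) (Fin k) ℝ} {g h H r : Fin k → ℝ} {ν μ ρ : ℝ}
    (hA : A.IsSymm) (hstate : A = Fᵀ * A * F + ν • vecMulVec h h - μ • vecMulVec H H)
    (hr : r = Fᵀ *ᵥ (A *ᵥ g) + ν • h - μ • H) (hρ : ρ = g ⬝ᵥ (A *ᵥ g) + ν - μ + 1) :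
    spectralGap F g h H ν μ =
      ((F - vecMulVec g r).charpoly - F.charpoly) * F.charpolyRev +
        ((F - vecMulVec g r).charpolyRev - F.charpolyRev) * F.charpoly +
        C ρ * (F.charpoly * F.charpolyRev) := by
  refine eq_of_eval_eq_of_ne_zero
    (mul_ne_zero (charpoly_monic F).ne_zero (charpolyRev_ne_zero F)) fun z hz => ?_
  rw [eval_mul] at hz
  obtain ⟨x, hx⟩ := exists_resolvent (left_ne_zero_of_mul hz) g
  obtain ⟨y, hy⟩ := exists_resolventRev (right_ne_zero_of_mul hz) g
  simp only [spectralGap, eval_add, eval_sub, eval_mul, eval_C, eval_charpoly_sub_vecMulVec hx,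
    eval_charpolyRev_sub_vecMulVec hy]
  -- the states at `z` and `z⁻¹` after one step have the same `A`-product as before
  have hstep : (F *ᵥ x + g) ⬝ᵥ (A *ᵥ (F *ᵥ y + g)) = x ⬝ᵥ (A *ᵥ y) := by
    rw [hx, smul_dotProduct, ← dotProduct_smul, ← mulVec_smul, hy]
  have hswap : ∀ u w : Fin k → ℝ, u ⬝ᵥ (A *ᵥ w) = w ⬝ᵥ (A *ᵥ u) := fun u w => by
    rw [dotProduct_mulVec, ← mulVec_transpose, hA.eq, dotProduct_comm]
  have hcross : ∀ u : Fin k → ℝ,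
      (F *ᵥ u) ⬝ᵥ (A *ᵥ g) = r ⬝ᵥ u - ν * (h ⬝ᵥ u) + μ * (H ⬝ᵥ u) := by
    intro u
    rw [hr]
    simp only [sub_dotProduct, add_dotProduct, smul_dotProduct, smul_eq_mul]
    rw [dotProduct_comm (Fᵀ *ᵥ _), dotProduct_mulVec u, vecMul_transpose]
    ring
  have hquad : (F *ᵥ x) ⬝ᵥ (A *ᵥ (F *ᵥ y)) =
      x ⬝ᵥ (A *ᵥ y) - ν * ((h ⬝ᵥ x) * (h ⬝ᵥ y)) + μ * ((H ⬝ᵥ x) * (H ⬝ᵥ y)) := by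
    have h1 : x ⬝ᵥ (A *ᵥ y) =
        x ⬝ᵥ ((Fᵀ * A * F + ν • vecMulVec h h - μ • vecMulVec H H) *ᵥ y) := by
      rw [← hstate]
    rw [sub_mulVec, add_mulVec, smul_mulVec, smul_mulVec, vecMulVec_mulVec, vecMulVec_mulVec,
      ← mulVec_mulVec, ← mulVec_mulVec, dotProduct_sub, dotProduct_add, dotProduct_mulVec x Fᵀ,
      vecMul_transpose] at h1
    simp only [dotProduct_smul, smul_eq_mul, op_smul_eq_smul, dotProduct_comm x h,
      dotProduct_comm x H] at h1
    linear_combination -h1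
  rw [mulVec_add, dotProduct_add, add_dotProduct, add_dotProduct, hquad, hcross x,
    hswap g (F *ᵥ y), hcross y] at hstep
  linear_combination (-(F.charpoly.eval z * F.charpolyRev.eval z)) * (hstep + hρ)

/-- If the spectral gap vanishes identically, then the certificate exists: the characteristic
polynomial of `F` is coprime to its reversal, so that the residuals vanish. -/
theorem exists_isDualCertificate {F : Matrix (Fin k) (Fin k) ℝ} {g h H : Fin k → ℝ} {ν μ : ℝ}
    (hF : ∀ z ∈ eigenvaluesC F, ‖z‖ < 1)
    (hctrl : ∀ (v : Fin k → ℂ) (z : ℂ), v ᵥ* F.map (algebraMap ℝ ℂ) = z • v →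
      v ⬝ᵥ (algebraMap ℝ ℂ ∘ g) = 0 → v = 0)
    (hgap : spectralGap F g h H ν μ = 0) :
    ∃ A, IsDualCertificate F g h H A ν μ := by
  obtain ⟨A, hA, hstate⟩ := exists_lyapunov hF
    (((isSymm_vecMulVec_self h).smul ν).sub ((isSymm_vecMulVec_self H).smul μ))
  rw [← add_sub_assoc] at hstate
  obtain ⟨r, hr⟩ : ∃ r, r = Fᵀ *ᵥ (A *ᵥ g) + ν • h - μ • H := ⟨_, rfl⟩
  obtain ⟨ρ, hρ⟩ : ∃ ρ, ρ = g ⬝ᵥ (A *ᵥ g) + ν - μ + 1 := ⟨_, rfl⟩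
  have hid := spectralGap_eq hA hstate hr hρ
  rw [hgap] at hid
  have hchar : (F - vecMulVec g r).charpoly = F.charpoly := by
    have hdvd : F.charpoly ∣ ((F - vecMulVec g r).charpoly - F.charpoly) * F.charpolyRev :=
      ⟨-((F - vecMulVec g r).charpolyRev - F.charpolyRev) - C ρ * F.charpolyRev,
        by linear_combination -hid⟩
    have hdvd' := (isCoprime_charpoly_charpolyRev hF).dvd_of_dvd_mul_right hdvd
    refine sub_eq_zero.mp (eq_zero_of_dvd_of_degree_lt hdvd' ?_)
    have hdeg : (F - vecMulVec g r).charpoly.degree = F.charpoly.degree := by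
      rw [charpoly_degree_eq_dim, charpoly_degree_eq_dim]
    rw [← hdeg]
    exact degree_sub_lt_left hdeg (charpoly_monic _).ne_zero
      (by rw [(charpoly_monic _).leadingCoeff, (charpoly_monic _).leadingCoeff])
  have hρ0 : ρ = 0 := by
    rw [← reverse_charpoly (F - vecMulVec g r), hchar, reverse_charpoly, sub_self, sub_self,
      zero_mul, zero_mul, zero_add, zero_add, eq_comm, mul_eq_zero, C_eq_zero] at hid
    exact hid.resolve_right (mul_ne_zero (charpoly_monic F).ne_zero (charpolyRev_ne_zero F))
  have hr0 : r = 0 := by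
    have h1 := eq_zero_of_charpoly_sub_vecMulVec hctrl (r := algebraMap ℝ ℂ ∘ r) (by
      have h2 : F.map (algebraMap ℝ ℂ) - vecMulVec (algebraMap ℝ ℂ ∘ g) (algebraMap ℝ ℂ ∘ r) =
          (F - vecMulVec g r).map (algebraMap ℝ ℂ) := by
        ext i j
        simp [vecMulVec_apply]
      rw [h2, charpoly_map, hchar, charpoly_map])
    ext i
    simpa using congrFun h1 i
  exact ⟨A, hA, hstate, by rw [← hr, hr0], by rw [← hρ, hρ0]⟩

/-- Controllability from `G` passes on to the gain `Γ`, unless an eigenvalue of `F` is the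
reciprocal of an eigenvalue of `F - G h`: if `v` is a left eigenvector of `F` orthogonal to `Γ`,
then `S v'` is an eigenvector of `F - G h` for the reciprocal eigenvalue. -/
theorem IsDARESol.gain_controllable {F : Matrix (Fin k) (Fin k) ℝ} {G h : Fin k → ℝ}
    {S : Matrix (Fin k) (Fin k) ℝ} (hS : IsDARESol F G h S)
    (hG : ∀ (v : Fin k → ℂ) (z : ℂ), v ᵥ* F.map (algebraMap ℝ ℂ) = z • v →
      v ⬝ᵥ (algebraMap ℝ ℂ ∘ G) = 0 → v = 0)
    (hdisj : ∀ z ∈ eigenvaluesC F, z ≠ 0 → z⁻¹ ∉ eigenvaluesC (F - vecMulVec G h))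
    (v : Fin k → ℂ) (z : ℂ) (hv : v ᵥ* F.map (algebraMap ℝ ℂ) = z • v)
    (hΓ : v ⬝ᵥ (algebraMap ℝ ℂ ∘ gain F G h S) = 0) : v = 0 := by
  by_contra hv0
  set φ := algebraMap ℝ ℂ with hφ
  set u : Fin k → ℂ := S.map φ *ᵥ v with hu
  set c : ℂ := v ⬝ᵥ (φ ∘ G) with hc
  have hc0 : c ≠ 0 := fun h0 => hv0 (hG v z hv h0)
  have hvS : v ᵥ* S.map φ = u := by
    rw [hu, ← mulVec_transpose, ← transpose_map, hS.symm.eq]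
  have hgain : F *ᵥ (S *ᵥ h) + G = innovVar h S • gain F G h S := by
    rw [innovVar_smul_gain (F := F) (G := G) hS.denom_ne, sub_add_cancel]
  -- the gain equation, seen along `v`
  have h1 : z * (u ⬝ᵥ (φ ∘ h)) + c = 0 := by
    have h2 : φ ∘ (F *ᵥ (S *ᵥ h) + G) = F.map φ *ᵥ (S.map φ *ᵥ (φ ∘ h)) + φ ∘ G := by
      ext i
      simp [RingHom.map_mulVec, Function.comp_def]
    have h3 : v ⬝ᵥ (φ ∘ (F *ᵥ (S *ᵥ h) + G)) = 0 := by
      have : φ ∘ (innovVar h S • gain F G h S) = φ (innovVar h S) • (φ ∘ gain F G h S) := by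
        ext i
        simp
      rw [hgain, this, dotProduct_smul, hΓ, smul_zero]
    rwa [h2, dotProduct_add, dotProduct_mulVec, hv, dotProduct_mulVec, smul_vecMul, hvS,
      smul_dotProduct, smul_eq_mul] at h3
  -- the Riccati equation, seen along `v`
  have h2 : u = z • (F.map φ *ᵥ u) + c • (φ ∘ G) := by
    have h3 : S.map φ = F.map φ * S.map φ * (F.map φ)ᵀ + vecMulVec (φ ∘ G) (φ ∘ G) -
        φ (innovVar h S) • vecMulVec (φ ∘ gain F G h S) (φ ∘ gain F G h S) := by
      have h4 := hS.eq
      rw [hgain] at h4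
      have h5 := congrArg (fun M => M.map φ) h4
      refine h5.trans ?_
      have h6 : F.map φ * S.map φ * (F.map φ)ᵀ = (F * S * Fᵀ).map φ := by
        rw [Matrix.map_mul, Matrix.map_mul, transpose_map]
      rw [h6]
      ext i j
      have := hS.denom_ne
      have : (innovVar h S : ℂ) ≠ 0 := by exact_mod_cast this
      simp [vecMulVec_apply, hφ]
      field_simp
    rw [← hvS]
    nth_rewrite 1 [h3]
    rw [vecMul_sub, vecMul_add, ← vecMul_vecMul, ← vecMul_vecMul, hv,
      vecMul_vecMulVec, vecMul_smul, vecMul_vecMulVec, hΓ, smul_vecMul, smul_vecMul,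
      vecMul_transpose, zero_smul, smul_zero, sub_zero]
  have hz0 : z ≠ 0 := by
    rintro rfl
    rw [zero_mul, zero_add] at h1
    exact hc0 h1
  have hu0 : u ≠ 0 := by
    intro h0
    rw [h0, zero_dotProduct, mul_zero, zero_add] at h1
    exact hc0 h1
  refine hdisj z (mem_spectrum_iff_exists_vecMul.mpr ⟨v, hv0, hv⟩) hz0
    (mem_spectrum_iff_exists_mulVec.mpr ⟨u, hu0, ?_⟩)
  have hE : (F - vecMulVec G h).map φ = F.map φ - vecMulVec (φ ∘ G) (φ ∘ h) := by
    ext i j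
    simp [vecMulVec_apply]
  rw [hE, eq_inv_smul_iff₀ hz0, sub_mulVec, vecMulVec_mulVec, op_smul_eq_smul, smul_sub, smul_smul,
    dotProduct_comm, eq_neg_of_add_eq_zero_left h1, neg_smul, sub_neg_eq_add]
  exact h2.symm

/-! ### Spectral condition and optimality -/

/-- The spectral gap has degree at most `2 k` and is self-reciprocal. It vanishes if it has `k`
zeros outside the closed unit disc, hence also their reciprocals, and the zero `1`. -/
theorem spectralGap_eq_zero {F : Matrix (Fin k) (Fin k) ℝ} {g h H : Fin k → ℝ} {ν μ : ℝ}
    {α : Fin k → ℂ} (hinj : Function.Injective α) (hout : ∀ i, 1 < ‖α i‖)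
    (hα : ∀ i, aeval (α i) (spectralGap F g h H ν μ) = 0)
    (h1 : aeval (1 : ℂ) (spectralGap F g h H ν μ) = 0) : spectralGap F g h H ν μ = 0 := by
  have h0 : ∀ i, α i ≠ 0 := fun i h => by
    have := hout i
    rw [h, norm_zero] at this
    linarith
  have hinv : ∀ i, aeval (α i)⁻¹ (spectralGap F g h H ν μ) = 0 := by
    intro i
    have h2 := hα i
    rw [aeval_spectralGap _ _ _ _ _ _ (h0 i), mul_eq_zero] at h2
    have h3 := h2.resolve_left (pow_ne_zero _ (h0 i))
    rw [aeval_spectralGap _ _ _ _ _ _ (inv_ne_zero (h0 i)), inv_inv]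
    linear_combination (α i)⁻¹ ^ k * h3
  have hlt : ∀ i, ‖(α i)⁻¹‖ < 1 := fun i => by
    rw [norm_inv]
    exact inv_lt_one_of_one_lt₀ (hout i)
  let f : Fin k ⊕ Fin k ⊕ Unit → ℂ := Sum.elim α (Sum.elim (fun i => (α i)⁻¹) fun _ => 1)
  have hf : Function.Injective f := by
    refine hinj.sumElim (Function.Injective.sumElim
      (fun i j hij => hinj (inv_injective hij)) (fun _ _ _ => rfl) ?_) ?_
    · intro i _ heq
      have := hlt i
      rw [heq, norm_one] at this
      exact lt_irrefl _ this
    · rintro i (j | j) heq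
      · have h2 := hout i
        rw [heq] at h2
        exact (hlt j).not_gt h2
      · have h2 := hout i
        rw [heq] at h2
        simp at h2
  have hmap : (spectralGap F g h H ν μ).map (algebraMap ℝ ℂ) = 0 := by
    refine eq_zero_of_natDegree_lt_card_of_eval_eq_zero _ hf ?_ ?_
    · rintro (i | i | i) <;> rw [eval_map_algebraMap]
      exacts [hα i, hinv i, h1]
    · rw [natDegree_map]
      have := natDegree_spectralGap_le F g h H ν μ
      simp only [Fintype.card_sum, Fintype.card_fin, Fintype.card_unit]
      omega
  exact (Polynomial.map_eq_zero _).mp hmap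

theorem outputSpectrum_eq_zero_of_revDet {p q X : Fin k → ℝ} {S : Matrix (Fin k) (Fin k) ℝ}
    {z : ℂ} (hz : revDet (stateF q) z = 0 ∨ revDet (stateF q) z⁻¹ = 0 ∨
      revDet (estimatorMatrix p q X S) z = 0) : outputSpectrum p q X S z = 0 := by
  rw [outputSpectrum]
  rcases hz with h | h | h <;> simp [h]

/-- The hypotheses on the output spectrum yield a dual certificate with nonnegative `ν` and with
`μ = σ² / lam`. -/
theorem exists_isDualCertificate_of_outputSpectrum {p q X : Fin k → ℝ}
    {S : Matrix (Fin k) (Fin k) ℝ} (hq : IsStablePoly (unitPoly q))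
    (hS : IsStabilizingSol (stateF q) (inputG k) (X + outputH p q) S) (hpd : S.PosDef)
    {α : Fin k → ℂ} (hα_inj : Function.Injective α)
    (hα : eigenvaluesC (stateF q - vecMulVec (inputG k) (X + outputH p q)) = Set.range α)
    (hα_out : ∀ i, 1 < ‖α i‖) {lam : ℝ} (hlam_pos : 0 < lam)
    (hlam : ∀ i, outputSpectrum p q X S (α i) = (lam : ℂ))
    (hlam_min : lam ≤ (outputSpectrum p q X S 1).re) :
    ∃ (A : Matrix (Fin k) (Fin k) ℝ) (ν : ℝ), 0 ≤ ν ∧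
      IsDualCertificate (stateF q) (gain (stateF q) (inputG k) (X + outputH p q) S)
        (X + outputH p q) (outputH p q) A ν (innovVar (X + outputH p q) S / lam) := by
  set F := stateF q with hF
  set G := inputG k
  set h := X + outputH p q with hh
  set Γ := gain F G h S with hΓ
  set Fc := F - vecMulVec Γ h with hFc
  set FH := F - vecMulVec Γ (outputH p q) with hFH
  set ψ := innovVar h S with hψ
  have hest : estimatorMatrix p q X S = FH := rfl
  have hFstab := stateF_stable hq
  have h0 : ∀ i, α i ≠ 0 := fun i h => by
    have := hα_out i
    rw [h, norm_zero] at this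
    linarith
  have hlamC : (lam : ℂ) ≠ 0 := by exact_mod_cast hlam_pos.ne'
  have hden : ∀ i, revDet F (α i) ≠ 0 ∧ revDet F (α i)⁻¹ ≠ 0 := fun i =>
    ⟨fun h2 => hlamC ((hlam i).symm.trans (outputSpectrum_eq_zero_of_revDet (.inl h2))),
      fun h2 => hlamC ((hlam i).symm.trans (outputSpectrum_eq_zero_of_revDet (.inr (.inl h2))))⟩
  have hnot_one : ∀ M : Matrix (Fin k) (Fin k) ℝ, (∀ μ ∈ eigenvaluesC M, ‖μ‖ < 1) →
      (1 - M).det ≠ 0 := by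
    intro M hM h2
    have h3 : revDet M 1 = 0 := by rw [revDet_one, h2, Complex.ofReal_zero]
    have := hM _ ((revDet_eq_zero_iff one_ne_zero).mp h3)
    simp at this
  have hdF := hnot_one F hFstab
  have hdc := hnot_one Fc hS.stable
  -- `ν` is chosen to make the spectral gap vanish at `z = 1`
  set ν := (ψ / lam * (1 - FH).det ^ 2 - (1 - F).det ^ 2) / (1 - Fc).det ^ 2 with hν
  have hν0 : 0 ≤ ν := by
    rw [outputSpectrum, hest, inv_one, revDet_one, revDet_one] at hlam_min
    norm_cast at hlam_min
    have h2 : lam * (1 - F).det ^ 2 ≤ ψ * (1 - FH).det ^ 2 := by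
      have h3 : ψ * ((1 - FH).det / (1 - F).det) * ((1 - FH).det / (1 - F).det) =
          ψ * (1 - FH).det ^ 2 / (1 - F).det ^ 2 := by
        field_simp
      rw [← le_div_iff₀ (by positivity), ← h3]
      exact hlam_min
    refine div_nonneg ?_ (sq_nonneg _)
    rw [sub_nonneg, div_mul_eq_mul_div, le_div_iff₀ hlam_pos, mul_comm]
    exact h2
  have hgap : spectralGap F Γ h (outputH p q) ν (ψ / lam) = 0 := by
    refine spectralGap_eq_zero hα_inj hα_out (fun i => ?_) ?_
    · have hrefl : revDet Fc (α i) = 0 :=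
        (revDet_eq_zero_iff (h0 i)).mpr
          (hS.sol.inv_mem_eigenvaluesC hpd (hα ▸ Set.mem_range_self i) (h0 i))
      have h2 := hlam i
      obtain ⟨hd1, hd2⟩ := hden i
      rw [outputSpectrum, hest, ← hh, ← hF, ← hψ] at h2
      rw [aeval_spectralGap _ _ _ _ _ _ (h0 i), hrefl, zero_mul, mul_zero, zero_sub]
      have h3 : (ψ : ℂ) * (revDet FH (α i) * revDet FH (α i)⁻¹) =
          lam * (revDet F (α i) * revDet F (α i)⁻¹) := by
        rw [← h2]
        generalize revDet F (α i)⁻¹ = d at hd2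
        field_simp
      push_cast
      rw [div_mul_eq_mul_div, h3, mul_div_cancel_left₀ _ hlamC]
      ring
    · rw [aeval_spectralGap _ _ _ _ _ _ one_ne_zero, inv_one, revDet_one, revDet_one, revDet_one,
        one_pow, one_mul]
      norm_cast
      rw [hν]
      field_simp
      ring
  obtain ⟨A, hA⟩ := exists_isDualCertificate hFstab
    (hS.sol.gain_controllable (fun v z hv hvG => stateF_controllable q hv hvG) (by
      intro z hz hz0 hmem
      rw [hα] at hmem
      obtain ⟨i, hi⟩ := hmem
      refine (hden i).1 ((revDet_eq_zero_iff (h0 i)).mpr ?_)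
      rwa [hi, inv_inv])) hgap
  exact ⟨A, ν, hν0, hA⟩

end GaussianFeedback

theorem proposition8 {k : ℕ} (p q : Fin k → ℝ) (hARMA : GaussianFeedback.IsARMA p q)
    (Pw : ℝ) (X : Fin k → ℝ) (S : Matrix (Fin k) (Fin k) ℝ)
    (hS : GaussianFeedback.IsStabilizingSol (GaussianFeedback.stateF q)
      (GaussianFeedback.inputG k) (X + GaussianFeedback.outputH p q) S)
    -- the estimate of the state is a causal function of the output
    (hcausal : ∀ μ ∈ GaussianFeedback.eigenvaluesC
      (GaussianFeedback.estimatorMatrix p q X S), ‖μ‖ ≤ 1)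
    (hpower : X ⬝ᵥ (S *ᵥ X) = Pw)
    (α : Fin k → ℂ) (hα_inj : Function.Injective α)
    (hα : GaussianFeedback.eigenvaluesC (GaussianFeedback.stateF q -
      Matrix.vecMulVec (GaussianFeedback.inputG k) (X + GaussianFeedback.outputH p q)) =
        Set.range α)
    (hα_out : ∀ i, 1 < ‖α i‖)
    (lam : ℝ) (hlam_pos : 0 < lam)
    (hlam : ∀ i, GaussianFeedback.outputSpectrum p q X S (α i) = (lam : ℂ))
    (hlam_min : ∀ z : ℂ, ‖z‖ = 1 → lam ≤ (GaussianFeedback.outputSpectrum p q X S z).re) :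
    S.PosDef ∧ GaussianFeedback.IsAdmissible p q Pw X S ∧
      ∀ (X' : Fin k → ℝ) (S' : Matrix (Fin k) (Fin k) ℝ),
        GaussianFeedback.IsAdmissible p q Pw X' S' →
          GaussianFeedback.rate p q X' S' ≤ GaussianFeedback.rate p q X S := by
  open GaussianFeedback in
  have hout : ∀ μ ∈ eigenvaluesC (stateF q - vecMulVec (inputG k) (X + outputH p q)),
      1 < ‖μ‖ := by
    rw [hα]
    rintro _ ⟨i, rfl⟩
    exact hα_out i
  have hpd := hS.posDef hout
  refine ⟨hpd, ⟨fun μ hμ => (hout μ hμ).ne', hS.isMaximalSol, hpower.le⟩, fun X' S' hX' => ?_⟩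
  obtain ⟨A, ν, hν, hA⟩ := exists_isDualCertificate_of_outputSpectrum hARMA.stable_den hS hpd
    hα_inj hα hα_out hlam_pos hlam (hlam_min 1 norm_one)
  -- positivity of the output spectrum excludes eigenvalues on the unit circle
  have hest : ∀ μ ∈ eigenvaluesC (estimatorMatrix p q X S), ‖μ‖ < 1 := by
    intro μ hμ
    refine lt_of_le_of_ne (hcausal μ hμ) fun h1 => ?_
    have h0 : μ ≠ 0 := by
      rintro rfl
      simp at h1
    have h2 := hlam_min μ⁻¹ (by rw [norm_inv, h1, inv_one])
    rw [outputSpectrum_eq_zero_of_revDet (.inr (.inr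
      ((revDet_eq_zero_iff (inv_ne_zero h0)).mpr (by rwa [inv_inv])))), Complex.zero_re] at h2
    linarith
  have hApos := hA.posSemidef hν hest
  have hS'pos : S'.PosSemidef := by
    simpa using hX'.maximal.maximal 0 (isDARESol_zero _ _ _)
  have hψ := one_le_innovVar hpd.posSemidef (X + outputH p q)
  have hψ' := one_le_innovVar hS'pos (X' + outputH p q)
  have hneg : ∀ Y : Fin k → ℝ, outputH p q - (Y + outputH p q) = -Y := fun Y => by abel
  have e1 := hA.innovVar_eq hS.sol
  have e2 := hA.innovVar_eq hX'.maximal.sol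
  simp only [hneg, mulVec_neg, dotProduct_neg, neg_dotProduct, neg_neg, sub_self, zero_dotProduct,
    mul_zero, sub_zero, hpower] at e1 e2
  have n1 := hApos.dotProduct_mulVec_nonneg
    (gain (stateF q) (inputG k) (X' + outputH p q) S' -
      gain (stateF q) (inputG k) (X + outputH p q) S)
  have n2 := hS'pos.dotProduct_mulVec_nonneg (X + outputH p q - (X' + outputH p q))
  rw [star_trivial] at n1 n2
  have n3 := mul_le_mul_of_nonneg_left hX'.power
    (div_nonneg (zero_le_one.trans hψ) hlam_pos.le)
  have n4 := mul_nonneg (zero_le_one.trans hψ') n1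
  have n5 := mul_nonneg hν n2
  refine mul_le_mul_of_nonneg_left (Real.log_le_log (by linarith) ?_) (by norm_num)
  linarith
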